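/- Let $S=K[X_1,\dots,X_n]$ be a polynomial ring over a field $K$, with $X_1>\dots>X_n$. Write a monomial $w$ of degree $d$ as $w=X^{(w)}_1\cdots X^{(w)}_d$ with variables $X^{(w)}_1\ge\dots\ge X^{(w)}_d$. For monomials $u,v$ of degrees $p\le q$ put $$\operatorname{ord}(u,v)=\Big(\prod_{j=q+1}^{q+p}X^{(uv)}_j,\ \prod_{j=1}^{q}X^{(uv)}_j\Big),$$ and, if $p=q$, $$\operatorname{sort}(u,v)=\Big(\prod_{j=1}^{p}X^{(uv)}_{2j-1},\ \prod_{j=1}^{p}X^{(uv)}_{2j}\Big).$$ Write $u>_{rev}v$ if $\deg u>\deg v$, or if $\deg u=\deg v$ and there is a $k$ with $X^{(u)}_k>X^{(v)}_k$ and $X^{(u)}_{k'}=X^{(v)}_{k'}$ for all $k'>k$. Let $1=d_0\le d_1\le\dots\le d_s$, let $I_0=(X_1,\dots,X_n)$, and for $1\le i\le s$ let $I_i\subset S$ be a monomial ideal whose minimal monomial generators all have degree $d_i$. For $0\le i\le s$ let $u_{i1}>_{rev}\dots>_{rev}u_{in_i}$ be the minimal monomial generators of $I_i$, and let $\mathcal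 M=\coprod_{i=0}^s\{u_{ij}:1\le j\le n_i\}$. Put $t_0=1$ and let $$\Psi:K[T_{ij}:u_{ij}\in\mathcal M]\to K[X_1,\dots,X_n,t_1,\dots,t_s]$$ be the $K$-algebra homomorphism with $\Psi(T_{ij})=u_{ij}t_i$. For $(i,j)\le_{lex}(i',j')$ write $u_{ij}\prec u_{i'j'}$ if either $i=i'$ and $\operatorname{sort}(u_{ij},u_{i'j'})=(u_{ij},u_{i'j'})$, or $i<i'$ and $\operatorname{ord}(u_{ij},u_{i'j'})=(u_{ij},u_{i'j'})$. Say that $\mathcal M$ is closed under comparability if for all $(i,j)<_{lex}(i',j')$ there are $u_{il},u_{i'l'}\in\mathcal M$ with $u_{ij}u_{i'j'}=u_{il}u_{i'l'}$ and $u_{il}\prec u_{i'l'}$. Suppose that $\mathcal M$ is closed under comparability, and let $$G=\{T_{ij}T_{i'j'}-T_{il}T_{i'l'}\ :\ (i,j)<_{lex}(i',j'),\ u_{ij}\nprec u_{i'j'},\ u_{ij}u_{i'j'}=u_{il}u_{i'l'},\ u_{il}\prec u_{i'l'}\}.$$ Then there is a monomial order on $K[T_{ij}:u_{ij}\in\mathcal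 M]$ such that 1. $G$ is a Gröbner basis of $\operatorname{Ker}\Psi$, and $(G)=\operatorname{Ker}\Psi$; 2. the initial term of each such binomial $T_{ij}T_{i'j'}-T_{il}T_{i'l'}$ is $T_{ij}T_{i'j'}$; 3. every element of $G$ is a nonzero homogeneous polynomial of degree $2$, and its initial term is squarefree. -/

import Mathlib

namespace MultiRees

/-- The standard factorization `X_1^{(u)} ≥ X_2^{(u)} ≥ ⋯ ≥ X_d^{(u)}` of the monomial with
exponent vector `u`, as the list of the indices of its variables. The variables are ordered by
`X_1 > X_2 > ⋯ > X_n`, so the indices are weakly increasing. Positions count from `0`. -/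
noncomputable def letters {n : ℕ} (u : Fin n →₀ ℕ) : List (Fin n) :=
  (Finsupp.toMultiset u).sort (· ≤ ·)

/-- The exponent vector of the variable in position `k` (counted from `0`) of the standard
factorization of `w`; it is `0` when `k` is at least the degree of `w`. -/
noncomputable def letterAt {n : ℕ} (w : Fin n →₀ ℕ) (k : ℕ) : Fin n →₀ ℕ :=
  ((letters w)[k]?).elim 0 (fun x => Finsupp.single x 1)

/-- `ord(u, v)` for monomials with `p = deg u ≤ q = deg v`: the first entry is the product of the
`p` smallest variables of `uv` (positions `q+1, …, q+p`, counted from `1`), the second one the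
product of the `q` largest. -/
noncomputable def ordering {n : ℕ} (u v : Fin n →₀ ℕ) : (Fin n →₀ ℕ) × (Fin n →₀ ℕ) :=
  (∑ j ∈ Finset.range u.degree, letterAt (u + v) (v.degree + j),
    ∑ j ∈ Finset.range v.degree, letterAt (u + v) j)

/-- `sort(u, v)` for monomials of equal degree `p`: the variables of `uv` in the positions
`1, 3, …, 2p-1`, and those in the positions `2, 4, …, 2p` (counted from `1`). -/
noncomputable def sorting {n : ℕ} (u v : Fin n →₀ ℕ) : (Fin n →₀ ℕ) × (Fin n →₀ ℕ) :=
  (∑ j ∈ Finset.range u.degree, letterAt (u + v) (2 * j),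
    ∑ j ∈ Finset.range u.degree, letterAt (u + v) (2 * j + 1))

/-- `u >_rev v`: either `deg u > deg v`, or the degrees agree and, in the last position in which
the standard factorizations differ, `u` has the larger variable, that is, the smaller index. -/
def RevGT {n : ℕ} (u v : Fin n →₀ ℕ) : Prop :=
  v.degree < u.degree ∨
    (u.degree = v.degree ∧
      ∃ k : ℕ, (∃ x ∈ (letters u)[k]?, ∃ y ∈ (letters v)[k]?, x < y) ∧
        ∀ k' : ℕ, k < k' → (letters u)[k']? = (letters v)[k']?)

/-- `A` is the set of (exponent vectors of the) minimal monomial generators of `I`. -/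
def IsMinimalMonomialGenerators {K : Type*} [Field K] {n : ℕ} (A : Set (Fin n →₀ ℕ))
    (I : Ideal (MvPolynomial (Fin n) K)) : Prop :=
  Ideal.span ((fun a => MvPolynomial.monomial a (1 : K)) '' A) = I ∧
    ∀ B ⊆ A, Ideal.span ((fun a => MvPolynomial.monomial a (1 : K)) '' B) = I → B = A

/-- The index pairs `(i, j)` of the monomials `u_{ij}`: `i` is the level, and `j` runs through
the `N i` generators of that level. -/
abbrev Idx {s : ℕ} (N : Fin (s + 1) → ℕ) : Type := Σ i : Fin (s + 1), Fin (N i)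

/-- The strict lexicographic order on index pairs. -/
def LexLT {s : ℕ} {N : Fin (s + 1) → ℕ} (a b : Idx N) : Prop :=
  a.1 < b.1 ∨ (a.1 = b.1 ∧ (a.2 : ℕ) < (b.2 : ℕ))

/-- `u_a ≺ u_b`, for index pairs `a ≤_lex b`: the pair `(u_a, u_b)` is fixed by sorting when both
are in the same level, and by ordering when the level of `a` is below that of `b`. -/
def Comparable {n s : ℕ} {N : Fin (s + 1) → ℕ} (u : (i : Fin (s + 1)) → Fin (N i) → (Fin n →₀ ℕ))
    (a b : Idx N) : Prop :=
  (LexLT a b ∨ a = b) ∧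
    ((a.1 = b.1 ∧ sorting (u a.1 a.2) (u b.1 b.2) = (u a.1 a.2, u b.1 b.2)) ∨
      (a.1 < b.1 ∧ ordering (u a.1 a.2) (u b.1 b.2) = (u a.1 a.2, u b.1 b.2)))

/-- The pair `(c, e)` is the comparable pair that replaces `(a, b)`: same levels, same product of
monomials, and `u_c ≺ u_e`. -/
def Replaces {n s : ℕ} {N : Fin (s + 1) → ℕ} (u : (i : Fin (s + 1)) → Fin (N i) → (Fin n →₀ ℕ))
    (a b c e : Idx N) : Prop :=
  c.1 = a.1 ∧ e.1 = b.1 ∧ u a.1 a.2 + u b.1 b.2 = u c.1 c.2 + u e.1 e.2 ∧ Comparable u c e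

/-- The family is closed under comparability. -/
def ClosedUnderComparability {n s : ℕ} {N : Fin (s + 1) → ℕ}
    (u : (i : Fin (s + 1)) → Fin (N i) → (Fin n →₀ ℕ)) : Prop :=
  ∀ a b : Idx N, LexLT a b → ∃ c e : Idx N, Replaces u a b c e

/-- `t_0 = 1`, and `t_1, …, t_s` are the last `s` variables of `K[X_1, …, X_n, t_1, …, t_s]`. -/
noncomputable def tVar (K : Type*) [Field K] (n s : ℕ) (i : Fin (s + 1)) :
    MvPolynomial (Fin n ⊕ Fin s) K :=
  Fin.cases 1 (fun k => MvPolynomial.X (Sum.inr k)) i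

/-- The map `Ψ : K[T_{ij}] → K[X_1, …, X_n, t_1, …, t_s]`, `T_{ij} ↦ u_{ij} t_i`. -/
noncomputable def Psi (K : Type*) [Field K] {n s : ℕ} {N : Fin (s + 1) → ℕ}
    (u : (i : Fin (s + 1)) → Fin (N i) → (Fin n →₀ ℕ)) :
    MvPolynomial (Idx N) K →ₐ[K] MvPolynomial (Fin n ⊕ Fin s) K :=
  MvPolynomial.aeval fun a : Idx N =>
    MvPolynomial.rename Sum.inl (MvPolynomial.monomial (u a.1 a.2) (1 : K)) * tVar K n s a.1

/-- The binomial `T_a T_b - T_c T_e`. -/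
noncomputable def binomial (K : Type*) [Field K] {s : ℕ} {N : Fin (s + 1) → ℕ}
    (a b c e : Idx N) : MvPolynomial (Idx N) K :=
  MvPolynomial.X a * MvPolynomial.X b - MvPolynomial.X c * MvPolynomial.X e

/-- The set `G` of the binomials `T_a T_b - T_c T_e` in which `(a, b)`, with `a <_lex b`, is an
incomparable pair and `(c, e)` the comparable pair that replaces it. -/
def G (K : Type*) [Field K] {n s : ℕ} {N : Fin (s + 1) → ℕ}
    (u : (i : Fin (s + 1)) → Fin (N i) → (Fin n →₀ ℕ)) : Set (MvPolynomial (Idx N) K) :=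
  {g | ∃ a b c e : Idx N, LexLT a b ∧ ¬ Comparable u a b ∧ Replaces u a b c e ∧
    g = binomial K a b c e}

/-- `B` is a Gröbner basis of the ideal `J` for the monomial order `m`: a finite subset of `J`
whose initial terms generate the initial ideal of `J`. -/
def IsGroebnerBasis {σ K : Type*} [Field K] (m : MonomialOrder σ) (B : Set (MvPolynomial σ K))
    (J : Ideal (MvPolynomial σ K)) : Prop :=
  B.Finite ∧ B ⊆ (J : Set (MvPolynomial σ K)) ∧
    Ideal.span (m.leadingTerm '' B) = Ideal.span (m.leadingTerm '' (J : Set (MvPolynomial σ K)))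

end MultiRees

/-! Everything is read off the counts `cum x u` of letters of `u` with index at most `x`; they
determine `u`. A pair fixed by sorting has counts differing by 0 or 1, the first being larger. In a
pair fixed by ordering, for every `x`, either the first monomial has no letter up to `x` or the
second has all of its letters there.

Two facts give the theorem. Uniqueness: a product of pairwise comparable generators is determined by
its image under `Psi` (`injOn_pairwiseComparable`). The image gives the number of factors in each
level and the total of each count; the totals must fill the levels from the top (`eq_of_stacked`),
and within a level the factors can be peeled off one by one (`eq_of_pairwise_interlaced`).
Termination: replacing an incomparable pair by a comparable one lowers the monomial in one fixed
monomial order (`Replaces.lt`).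

By closure under comparability, a monomial divisible by no initial monomial of `G` has pairwise
comparable factors. Such monomials have distinct images, so division by `G` reduces every kernel
element to 0. Hence `G` generates the kernel and its initial terms generate the initial ideal
(`span_eq_ker_of_injOn_standard`). -/

namespace MultiRees

/-! ### Monomial orders refined by a weight. -/

section WeightedOrder

variable {σ : Type*}

/-- An exponent vector as the pair of its weight and its image under a monomial order, with the
lexicographic order on pairs. -/
noncomputable def weightKey (m : MonomialOrder σ) (w : (σ →₀ ℕ) →+ ℕ) :
    (σ →₀ ℕ) →+ ℕ ×ₗ m.syn :=
  (toLexAddEquiv (ℕ × m.syn)).toAddMonoidHom.comp (w.prod m.toSyn.toAddMonoidHom)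

/-- The monomial order that compares the weights first and breaks ties by `m`. -/
noncomputable def weightedOrder (m : MonomialOrder σ) (w : (σ →₀ ℕ) →+ ℕ) : MonomialOrder σ where
  -- The key is injective, its second coordinate already determining the exponent vector, but it
  -- need not be surjective; the ordered monoid is therefore its range.
  syn := AddMonoidHom.mrange (weightKey m w)
  toSyn := AddEquiv.ofLeftInverse' (weightKey m w) (g := fun z => m.toSyn.symm (ofLex z).2)
    fun a => m.toSyn.symm_apply_apply a
  toSyn_monotone a b h := by
    have hw : w a ≤ w b := by
      rw [← add_tsub_cancel_of_le h, map_add]; exact Nat.le_add_right _ _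
    refine Prod.Lex.toLex_le_toLex.2 ?_
    rcases hw.lt_or_eq with hw | hw
    · exact Or.inl hw
    · exact Or.inr ⟨hw, m.toSyn_monotone h⟩
  wellFoundedLT_syn :=
    ⟨InvImage.wf Subtype.val (wellFounded_lt (α := ℕ ×ₗ m.syn))⟩

theorem weightedOrder_lt_iff (m : MonomialOrder σ) (w : (σ →₀ ℕ) →+ ℕ) (a b : σ →₀ ℕ) :
    (weightedOrder m w).toSyn a < (weightedOrder m w).toSyn b ↔
      w a < w b ∨ w a = w b ∧ m.toSyn a < m.toSyn b :=
  Prod.Lex.toLex_lt_toLex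

theorem weightedOrder_lt_of_weight_lt {m : MonomialOrder σ} {w : (σ →₀ ℕ) →+ ℕ} {a b : σ →₀ ℕ}
    (h : w a < w b) : (weightedOrder m w).toSyn a < (weightedOrder m w).toSyn b :=
  (weightedOrder_lt_iff m w a b).2 (Or.inl h)

theorem weightedOrder_lt_of_weight_eq {m : MonomialOrder σ} {w : (σ →₀ ℕ) →+ ℕ} {a b : σ →₀ ℕ}
    (h : w a = w b) (h' : m.toSyn a < m.toSyn b) :
    (weightedOrder m w).toSyn a < (weightedOrder m w).toSyn b :=
  (weightedOrder_lt_iff m w a b).2 (Or.inr ⟨h, h'⟩)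

end WeightedOrder

/-! ### Gröbner bases of kernels of monomial maps. -/

section ToricIdeal

open MvPolynomial

variable {σ ρ K : Type*} [Field K]

theorem map_monomial_of_map_X (F : MvPolynomial σ K →ₐ[K] MvPolynomial ρ K) (E : σ → ρ →₀ ℕ)
    (hF : ∀ a, F (X a) = monomial (E a) 1) (β : σ →₀ ℕ) (c : K) :
    F (monomial β c) = monomial (Finsupp.linearCombination ℕ E β) c := by
  rw [monomial_eq, map_mul, Finsupp.prod, map_prod, Finsupp.linearCombination_apply, Finsupp.sum,
    monomial_sum_index]
  have hC : F (C c) = C c := F.commutes c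
  simp [hF, monomial_pow, hC]

/-- A polynomial in the kernel of a monomial map vanishes if that map is injective on its
monomials. -/
theorem eq_zero_of_map_eq_zero (F : MvPolynomial σ K →ₐ[K] MvPolynomial ρ K) (E : σ → ρ →₀ ℕ)
    (hF : ∀ a, F (X a) = monomial (E a) 1) {r : MvPolynomial σ K} (hr : F r = 0)
    (hinj : Set.InjOn (Finsupp.linearCombination ℕ E) (r.support : Set (σ →₀ ℕ))) : r = 0 := by
  classical
  by_contra h0
  -- No other monomial of `r` has the same image as `α`, so the coefficient of `F r` at that image
  -- is the coefficient of `r` at `α`.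
  obtain ⟨α, hα⟩ := support_nonempty.2 h0
  have h1 := congrArg (coeff (Finsupp.linearCombination ℕ E α)) hr
  rw [r.as_sum, map_sum, coeff_sum, Finset.sum_eq_single α] at h1
  · rw [map_monomial_of_map_X F E hF, coeff_monomial, if_pos rfl, coeff_zero] at h1
    exact mem_support_iff.1 hα h1
  · intro β hβ hne
    rw [map_monomial_of_map_X F E hF, coeff_monomial, if_neg]
    exact fun h => hne (hinj hβ hα h)
  · exact fun h => absurd hα h

variable (m : MonomialOrder σ)

/-- A criterion for a set of monic elements of the kernel of a monomial map to generate the kernel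
and its initial ideal: distinct standard monomials have distinct images. -/
theorem span_eq_ker_of_injOn_standard (F : MvPolynomial σ K →ₐ[K] MvPolynomial ρ K)
    (E : σ → ρ →₀ ℕ) (hF : ∀ a, F (X a) = monomial (E a) 1) (B : Set (MvPolynomial σ K))
    (hB : B ⊆ (RingHom.ker F : Set (MvPolynomial σ K))) (hmonic : ∀ b ∈ B, m.Monic b)
    (hinj : Set.InjOn (Finsupp.linearCombination ℕ E) {α | ∀ b ∈ B, ¬ m.degree b ≤ α}) :
    Ideal.span B = RingHom.ker F ∧
      Ideal.span (m.leadingTerm '' B) =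
        Ideal.span (m.leadingTerm '' (RingHom.ker F : Set (MvPolynomial σ K))) := by
  classical
  have hdiv : ∀ f ∈ RingHom.ker F, ∃ g : B →₀ MvPolynomial σ K,
      f = Finsupp.linearCombination _ (fun b : B => (b : MvPolynomial σ K)) g ∧
        ∀ b : B, m.toSyn (m.degree ((b : MvPolynomial σ K) * g b)) ≤ m.toSyn (m.degree f) := by
    intro f hf
    obtain ⟨g, r, hfr, hdeg, hr⟩ := m.div_set
      (fun b hb => by rw [(hmonic b hb).leadingCoeff_eq_one]; exact isUnit_one) f
    have hmem : Finsupp.linearCombination _ (fun b : B => (b : MvPolynomial σ K)) g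
        ∈ RingHom.ker F := by
      rw [Finsupp.linearCombination_apply]
      exact Ideal.sum_mem _ fun b _ => Ideal.mul_mem_left _ _ (hB b.2)
    -- The remainder lies in the kernel and involves only standard monomials.
    have hr0 : r = 0 := by
      refine eq_zero_of_map_eq_zero F E hF ?_ (hinj.mono fun c hc => hr c hc)
      have h := (Submodule.add_mem_iff_right _ hmem).1 (hfr ▸ hf)
      exact h
    exact ⟨g, by rw [hfr, hr0, add_zero], hdeg⟩
  constructor
  · refine le_antisymm (Ideal.span_le.2 hB) fun f hf => ?_
    obtain ⟨g, hfg, -⟩ := hdiv f hf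
    rw [hfg, Finsupp.linearCombination_apply]
    exact Ideal.sum_mem _ fun b _ => Ideal.mul_mem_left _ _ (Ideal.subset_span b.2)
  · refine le_antisymm (Ideal.span_mono (Set.image_mono hB)) (Ideal.span_le.2 ?_)
    rintro _ ⟨f, hf, rfl⟩
    by_cases h0 : f = 0
    · simp [h0]
    obtain ⟨g, hfg, hdeg⟩ := hdiv f hf
    have hcoeff : coeff (m.degree f) f ≠ 0 := m.coeff_degree_ne_zero_iff.2 h0
    -- Some summand must contribute the leading monomial of `f`. Since the division bounds its
    -- degree by that of `f`, this monomial is also the summand's own leading monomial.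
    obtain ⟨b, hb⟩ : ∃ b : B, coeff (m.degree f) ((b : MvPolynomial σ K) * g b) ≠ 0 := by
      by_contra hne
      push Not at hne
      apply hcoeff
      nth_rewrite 2 [hfg]
      rw [Finsupp.linearCombination_apply, Finsupp.sum, coeff_sum]
      exact Finset.sum_eq_zero fun b _ => by rw [smul_eq_mul, mul_comm]; exact hne b
    have hprod : (b : MvPolynomial σ K) * g b ≠ 0 := fun h => hb (by rw [h, coeff_zero])
    have hdeg_eq : m.degree f = m.degree (b : MvPolynomial σ K) + m.degree (g b) := by
      rw [← m.degree_mul' hprod]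
      exact m.toSyn.injective (le_antisymm (m.le_degree (mem_support_iff.2 hb)) (hdeg b))
    have hlt : m.leadingTerm f =
        monomial (m.degree (g b)) (m.leadingCoeff f) * m.leadingTerm (b : MvPolynomial σ K) := by
      rw [MonomialOrder.leadingTerm, MonomialOrder.leadingTerm,
        (hmonic b b.2).leadingCoeff_eq_one, monomial_mul, mul_one, hdeg_eq, add_comm]
    rw [hlt]
    exact Ideal.mul_mem_left _ _ (Ideal.subset_span ⟨b, b.2, rfl⟩)

end ToricIdeal

end MultiRees

namespace MultiRees

/-! ### Cumulative letter counts, sorting and ordering. -/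

section Cumulative

variable {n : ℕ}

/-- The number of variables of the monomial with exponent vector `u` whose index is at most `x`. -/
noncomputable def cum (x : Fin n) : (Fin n →₀ ℕ) →+ ℕ :=
  ∑ y ∈ Finset.Iic x, Finsupp.applyAddHom y

theorem cum_apply (x : Fin n) (u : Fin n →₀ ℕ) : cum x u = ∑ y ∈ Finset.Iic x, u y := by
  simp [cum]

theorem cum_le_degree (x : Fin n) (u : Fin n →₀ ℕ) : cum x u ≤ u.degree := by
  rw [cum_apply, Finsupp.degree_eq_sum]
  exact Finset.sum_le_sum_of_subset (Finset.subset_univ _)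

theorem cum_single (x y : Fin n) : cum x (Finsupp.single y 1) = if y ≤ x then 1 else 0 := by
  rw [cum_apply]
  simp [Finsupp.single_apply]

theorem eq_of_cum_eq {u v : Fin n →₀ ℕ} (h : ∀ x, cum x u = cum x v) : u = v := by
  ext x
  induction x using WellFoundedLT.induction with
  | ind x ih =>
    have hx := h x
    rw [cum_apply, cum_apply, ← Finset.Iio_insert, Finset.sum_insert (by simp),
      Finset.sum_insert (by simp),
      Finset.sum_congr rfl fun y hy => ih y (Finset.mem_Iio.1 hy)] at hx
    exact Nat.add_right_cancel hx

theorem countP_letters (x : Fin n) (w : Fin n →₀ ℕ) :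
    (letters w).countP (· ≤ x) = cum x w := by
  have h1 : (letters w).countP (· ≤ x) = Multiset.countP (· ≤ x) (Finsupp.toMultiset w) := by
    rw [letters, ← Multiset.coe_countP, Multiset.sort_eq]
  have h2 : (Multiset.countPAddMonoidHom (· ≤ x)).comp
      (Finsupp.toMultiset : (Fin n →₀ ℕ) →+ Multiset (Fin n)) = cum x := by
    refine Finsupp.addHom_ext' fun y => AddMonoidHom.ext_nat ?_
    simp [cum_single, ← Multiset.cons_zero, Multiset.countP_cons]
  rw [h1, ← h2]
  rfl

/-- In a weakly increasing list the entries at most `x` form an initial segment. The default 0 past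
the end is consistent, since that segment is no longer than the list. -/
theorem elim_getElem?_of_pairwise_le {α : Type*} [LinearOrder α] (x : α) :
    ∀ (l : List α) (_ : l.Pairwise (· ≤ ·)) (k : ℕ),
      (l[k]?).elim 0 (fun y => if y ≤ x then 1 else 0) =
        if k < l.countP (· ≤ x) then 1 else 0
  | [], _, k => by simp
  | a :: l, h, k => by
    rw [List.pairwise_cons] at h
    have ih := elim_getElem?_of_pairwise_le x l h.2
    by_cases hax : a ≤ x
    · cases k with
      | zero => simp [hax]
      | succ k => simp [hax, ih k]
    · have h0 : l.countP (· ≤ x) = 0 :=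
        List.countP_eq_zero.2 fun b hb => by simpa using lt_of_lt_of_le (not_le.1 hax) (h.1 b hb)
      cases k with
      | zero => simp [hax, h0]
      | succ k => simp [hax, ih k, h0]

theorem cum_letterAt (x : Fin n) (w : Fin n →₀ ℕ) (k : ℕ) :
    cum x (letterAt w k) = if k < cum x w then 1 else 0 := by
  rw [← countP_letters x w, ← elim_getElem?_of_pairwise_le x (letters w)
    (Multiset.pairwise_sort _ _) k, letterAt]
  cases (letters w)[k]? with
  | none => simp
  | some y => simp [cum_single]

/-- Among the first `C` positions, those with even 0-based index number `⌈C/2⌉`. Equality of degrees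
bounds this by the number of letters taken, so nothing is cut off. -/
theorem cum_sorting_fst (x : Fin n) {u v : Fin n →₀ ℕ} (h : u.degree = v.degree) :
    cum x (sorting u v).1 = (cum x (u + v) + 1) / 2 := by
  have key : ∀ p C : ℕ, ∑ j ∈ Finset.range p, (if 2 * j < C then 1 else 0) =
      min p ((C + 1) / 2) := by
    intro p C
    induction p with
    | zero => simp
    | succ p ih => rw [Finset.sum_range_succ, ih]; split_ifs <;> omega
  have hle := cum_le_degree x (u + v)
  rw [map_add Finsupp.degree] at hle
  simp only [sorting, map_sum, cum_letterAt, key]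
  omega

theorem cum_sorting_snd (x : Fin n) {u v : Fin n →₀ ℕ} (h : u.degree = v.degree) :
    cum x (sorting u v).2 = cum x (u + v) / 2 := by
  have key : ∀ p C : ℕ, ∑ j ∈ Finset.range p, (if 2 * j + 1 < C then 1 else 0) =
      min p (C / 2) := by
    intro p C
    induction p with
    | zero => simp
    | succ p ih => rw [Finset.sum_range_succ, ih]; split_ifs <;> omega
  have hle := cum_le_degree x (u + v)
  rw [map_add Finsupp.degree] at hle
  simp only [sorting, map_sum, cum_letterAt, key]
  omega

theorem cum_ordering_snd (x : Fin n) (u v : Fin n →₀ ℕ) :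
    cum x (ordering u v).2 = min v.degree (cum x (u + v)) := by
  have key : ∀ p C : ℕ, ∑ j ∈ Finset.range p, (if j < C then 1 else 0) = min p C := by
    intro p C
    induction p with
    | zero => simp
    | succ p ih => rw [Finset.sum_range_succ, ih]; split_ifs <;> omega
  simp only [ordering, map_sum, cum_letterAt, key]

/-- A pair that is fixed by sorting has interlaced variables. -/
theorem cum_interlaced_of_sorting_eq {u v : Fin n →₀ ℕ} (h : u.degree = v.degree)
    (hs : sorting u v = (u, v)) (x : Fin n) : cum x v ≤ cum x u ∧ cum x u ≤ cum x v + 1 := by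
  have h1 := cum_sorting_fst x h
  have h2 := cum_sorting_snd x h
  rw [hs] at h1 h2
  dsimp only at h1 h2
  omega

/-- A pair `(u, v)` that is fixed by ordering has all variables of `v` before those of `u`. -/
theorem cum_separated_of_ordering_eq {u v : Fin n →₀ ℕ}
    (ho : ordering u v = (u, v)) (x : Fin n) : cum x u = 0 ∨ cum x v = v.degree := by
  have h2 := cum_ordering_snd x u v
  rw [ho, map_add] at h2
  dsimp only at h2
  omega

/-- The sum of the squares of the numbers of variables of `u` in intervals of indices. -/
noncomputable def sqWeight (u : Fin n →₀ ℕ) : ℕ :=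
  ∑ x, ∑ y, ((cum x u - cum y u : ℤ).natAbs ^ 2 + cum x u ^ 2)

theorem cast_sqWeight (u : Fin n →₀ ℕ) :
    (sqWeight u : ℤ) = ∑ x, ∑ y, ((cum x u - cum y u : ℤ) ^ 2 + (cum x u : ℤ) ^ 2) := by
  simp [sqWeight]

/-- With the sum fixed, `2(a² + b²) = (a + b)² + (a - b)²` depends only on the difference. A
balanced pair has the least difference its parity allows. -/
theorem sq_add_sq_of_balanced {a b c e : ℤ} (h : a + b = c + e) (h1 : c ≤ e + 1)
    (h2 : e ≤ c + 1) :
    c ^ 2 + e ^ 2 ≤ a ^ 2 + b ^ 2 ∧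
      (¬ (a ≤ b + 1 ∧ b ≤ a + 1) → c ^ 2 + e ^ 2 < a ^ 2 + b ^ 2) := by
  have hsum : (a + b) ^ 2 = (c + e) ^ 2 := by rw [h]
  have hce : (c - e) ^ 2 ≤ 1 := by
    rw [sq_le_one_iff_abs_le_one, abs_le]; omega
  constructor
  · rcases eq_or_ne a b with hab | hab
    · have h3 : c = e := by omega
      have h4 : a = c := by omega
      rw [← hab, ← h3, h4]
    · have h3 : 1 ≤ (a - b) ^ 2 := by
        rw [one_le_sq_iff_one_le_abs, le_abs]; omega
      nlinarith
  · intro hne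
    have h3 : 1 < (a - b) ^ 2 := by
      rw [one_lt_sq_iff_one_lt_abs, lt_abs]; omega
    nlinarith

/-- Replacing a pair of monomials by an interlaced pair with the same product, which is not the
same pair up to the order, decreases the sum of the weights. -/
theorem sqWeight_add_lt {a b c e : Fin n →₀ ℕ} (h : a + b = c + e)
    (hint : ∀ x, cum x e ≤ cum x c ∧ cum x c ≤ cum x e + 1)
    (h1 : ¬ (a = c ∧ b = e)) (h2 : ¬ (a = e ∧ b = c)) :
    sqWeight c + sqWeight e < sqWeight a + sqWeight b := by
  have hs : ∀ x, cum x a + cum x b = cum x c + cum x e := fun x => by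
    rw [← map_add, ← map_add, h]
  -- The differences `cum x c - cum x e` are 0 or 1, so the counts of `c` and `e` between two
  -- indices also differ by at most 1.
  have hA : ∀ x y,
      (cum x c - cum y c : ℤ) ^ 2 + (cum x e - cum y e : ℤ) ^ 2 ≤
        (cum x a - cum y a : ℤ) ^ 2 + (cum x b - cum y b : ℤ) ^ 2 ∧
      (¬ ((cum x a - cum y a : ℤ) ≤ (cum x b - cum y b : ℤ) + 1 ∧
          (cum x b - cum y b : ℤ) ≤ (cum x a - cum y a : ℤ) + 1) →
        (cum x c - cum y c : ℤ) ^ 2 + (cum x e - cum y e : ℤ) ^ 2 <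
        (cum x a - cum y a : ℤ) ^ 2 + (cum x b - cum y b : ℤ) ^ 2) := fun x y => by
    have := hs x
    have := hs y
    have := hint x
    have := hint y
    apply sq_add_sq_of_balanced <;> omega
  have hB : ∀ x, (cum x c : ℤ) ^ 2 + (cum x e : ℤ) ^ 2 ≤ (cum x a : ℤ) ^ 2 + (cum x b : ℤ) ^ 2 ∧
      (¬ ((cum x a : ℤ) ≤ cum x b + 1 ∧ (cum x b : ℤ) ≤ cum x a + 1) →
        (cum x c : ℤ) ^ 2 + (cum x e : ℤ) ^ 2 < (cum x a : ℤ) ^ 2 + (cum x b : ℤ) ^ 2) :=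
    fun x => by
      have := hs x
      have := hint x
      apply sq_add_sq_of_balanced <;> omega
  by_contra hlt
  have hle : ∀ x y,
      ((cum x c - cum y c : ℤ) ^ 2 + (cum x c : ℤ) ^ 2) +
          ((cum x e - cum y e : ℤ) ^ 2 + (cum x e : ℤ) ^ 2) ≤
        ((cum x a - cum y a : ℤ) ^ 2 + (cum x a : ℤ) ^ 2) +
          ((cum x b - cum y b : ℤ) ^ 2 + (cum x b : ℤ) ^ 2) := fun x y => by
    linarith [(hA x y).1, (hB x).1]
  have hnot : ∀ x y,
      ¬ (((cum x c - cum y c : ℤ) ^ 2 + (cum x c : ℤ) ^ 2) +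
          ((cum x e - cum y e : ℤ) ^ 2 + (cum x e : ℤ) ^ 2) <
        ((cum x a - cum y a : ℤ) ^ 2 + (cum x a : ℤ) ^ 2) +
          ((cum x b - cum y b : ℤ) ^ 2 + (cum x b : ℤ) ^ 2)) := fun x y hxy => by
    apply hlt
    zify
    simp only [cast_sqWeight, ← Finset.sum_add_distrib]
    exact Finset.sum_lt_sum (fun x _ => Finset.sum_le_sum fun y _ => hle x y)
      ⟨x, Finset.mem_univ _, Finset.sum_lt_sum (fun y _ => hle x y) ⟨y, Finset.mem_univ _, hxy⟩⟩
  have hA' : ∀ x y, (cum x a - cum y a : ℤ) ≤ (cum x b - cum y b : ℤ) + 1 ∧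
      (cum x b - cum y b : ℤ) ≤ (cum x a - cum y a : ℤ) + 1 := fun x y => by
    by_contra hne
    exact hnot x y (by linarith [(hA x y).2 hne, (hB x).1])
  have hB' : ∀ x, (cum x a : ℤ) ≤ cum x b + 1 ∧ (cum x b : ℤ) ≤ cum x a + 1 := fun x => by
    by_contra hne
    exact hnot x x (by linarith [(hA x x).1, (hB x).2 hne])
  -- If the weight did not drop, `cum x a - cum x b` lies in {-1, 0, 1}, and the interval terms
  -- forbid both signs from occurring. So one of `a`, `b` dominates throughout, and the pair is `(c,
  -- e)` or its swap.
  by_cases hpos : ∀ x, cum x b ≤ cum x a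
  · refine h1 ⟨eq_of_cum_eq fun x => ?_, eq_of_cum_eq fun x => ?_⟩ <;>
    · have := hs x
      have := hint x
      have := hB' x
      have := hpos x
      omega
  · push Not at hpos
    obtain ⟨y, hy⟩ := hpos
    refine h2 ⟨eq_of_cum_eq fun x => ?_, eq_of_cum_eq fun x => ?_⟩ <;>
    · have := hs x
      have := hint x
      have := hB' x
      have := hA' x y
      omega

end Cumulative

end MultiRees

namespace MultiRees

/-! ### Products of pairwise comparable generators are determined by their image. -/

section Uniqueness

/-- The bounds say that `c j₀` is the ceiling of `∑ A j * c j` divided by `∑ A j`, so the leading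
value depends only on size and product. Strictness comes from the term at `j₀` itself. -/
theorem sum_mul_bounds_of_interlaced {M : ℕ} {A : Fin M → ℕ} {c : Fin M → ℕ} {j₀ : Fin M}
    (h0 : A j₀ ≠ 0) (h : ∀ j, A j ≠ 0 → c j ≤ c j₀ ∧ c j₀ ≤ c j + 1) :
    ∑ j, A j * c j ≤ (∑ j, A j) * c j₀ ∧ (∑ j, A j) * c j₀ < ∑ j, A j * c j + ∑ j, A j := by
  constructor
  · rw [Finset.sum_mul]
    refine Finset.sum_le_sum fun j _ => ?_
    by_cases hj : A j = 0
    · simp [hj]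
    · exact Nat.mul_le_mul_left _ (h j hj).1
  · rw [Finset.sum_mul, ← Finset.sum_add_distrib]
    refine Finset.sum_lt_sum (fun j _ => ?_) ⟨j₀, Finset.mem_univ _, by omega⟩
    by_cases hj : A j = 0
    · simp [hj]
    · rw [← Nat.mul_succ]
      exact Nat.mul_le_mul_left _ (h j hj).2

/-- A multiset of pairwise interlaced monomials (with multiplicities `A`) is determined by its size
and its product. -/
theorem eq_of_pairwise_interlaced {M : ℕ} {X : Type*} {c : Fin M → X → ℕ}
    (hc : Function.Injective c) {A B : Fin M → ℕ}
    (hA : ∀ j j', j < j' → A j ≠ 0 → A j' ≠ 0 → ∀ x, c j' x ≤ c j x ∧ c j x ≤ c j' x + 1)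
    (hB : ∀ j j', j < j' → B j ≠ 0 → B j' ≠ 0 → ∀ x, c j' x ≤ c j x ∧ c j x ≤ c j' x + 1)
    (hsum : ∑ j, A j = ∑ j, B j) (hprod : ∀ x, ∑ j, A j * c j x = ∑ j, B j * c j x) :
    A = B := by
  induction hr : ∑ j, A j generalizing A B with
  | zero =>
    rw [hr] at hsum
    rw [Finset.sum_eq_zero_iff] at hr
    have hsum := Finset.sum_eq_zero_iff.1 hsum.symm
    ext j
    rw [hr j (Finset.mem_univ _), hsum j (Finset.mem_univ _)]
  | succ r ih =>
    have hfirst : ∀ D : Fin M → ℕ, ∑ j, D j = r + 1 →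
        (∀ j j', j < j' → D j ≠ 0 → D j' ≠ 0 → ∀ x, c j' x ≤ c j x ∧ c j x ≤ c j' x + 1) →
        ∃ j₀, D j₀ ≠ 0 ∧ ∀ j, D j ≠ 0 → ∀ x, c j x ≤ c j₀ x ∧ c j₀ x ≤ c j x + 1 := by
      intro D hD hpair
      have hex : ∃ j, D j ≠ 0 := by
        by_contra hne
        push Not at hne
        simp [hne] at hD
      obtain ⟨j₀, hj₀, hmin⟩ := WellFounded.has_min (wellFounded_lt (α := Fin M)) {j | D j ≠ 0} hex
      refine ⟨j₀, hj₀, fun j hj x => ?_⟩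
      rcases (not_lt.1 (hmin j hj)).eq_or_lt with rfl | hlt
      · omega
      · exact hpair _ _ hlt hj₀ hj x
    obtain ⟨a, ha, ha'⟩ := hfirst A hr hA
    obtain ⟨b, hb, hb'⟩ := hfirst B (hsum ▸ hr) hB
    -- The two leading monomials have the same counts, each being the same ceiling; one copy is then
    -- removed from both sides.
    obtain rfl : a = b := hc <| funext fun x => by
      have h1 := sum_mul_bounds_of_interlaced (c := fun j => c j x) ha fun j hj => ha' j hj x
      have h2 := sum_mul_bounds_of_interlaced (c := fun j => c j x) hb fun j hj => hb' j hj x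
      rw [← hsum, ← hprod x] at h2
      have h3 : c a x < c b x + 1 := Nat.lt_of_mul_lt_mul_left (a := ∑ j, A j) (by
        rw [Nat.mul_succ]; omega)
      have h4 : c b x < c a x + 1 := Nat.lt_of_mul_lt_mul_left (a := ∑ j, A j) (by
        rw [Nat.mul_succ]; omega)
      omega
    have hsplit : ∀ D : Fin M → ℕ, D a ≠ 0 →
        D = (fun j => D j - (Pi.single a 1 : Fin M → ℕ) j) + Pi.single a 1 := fun D hD => by
      ext j
      by_cases hj : j = a
      · subst hj; simp; omega
      · simp [hj]
    have hrec : ∀ D : Fin M → ℕ, D a ≠ 0 →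
        (∑ j, D j = ∑ j, (D j - (Pi.single a 1 : Fin M → ℕ) j) + 1) ∧
        ∀ x, ∑ j, D j * c j x =
          ∑ j, (D j - (Pi.single a 1 : Fin M → ℕ) j) * c j x + c a x := fun D hD => by
      constructor
      · conv_lhs => rw [hsplit D hD]
        simp [Finset.sum_add_distrib]
      · intro x
        conv_lhs => rw [hsplit D hD]
        simp [add_mul, Finset.sum_add_distrib, Pi.single_apply]
    obtain ⟨hA1, hA2⟩ := hrec A ha
    obtain ⟨hB1, hB2⟩ := hrec B hb
    rw [hsplit A ha, hsplit B hb]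
    congr 1
    refine ih (fun j j' hlt hj hj' => hA j j' hlt ?_ ?_) (fun j j' hlt hj hj' => hB j j' hlt ?_ ?_)
      ?_ (fun x => ?_) ?_
    · omega
    · omega
    · omega
    · omega
    · omega
    · have := hA2 x
      have := hB2 x
      have := hprod x
      omega
    · omega

/-- If the levels are filled from the top, so that a level that is not empty has only full levels
above it, then the contents of the levels are determined by their sum. -/
theorem eq_of_stacked {k : ℕ} {S S' F : Fin k → ℕ} (hS : ∀ i, S i ≤ F i) (hS' : ∀ i, S' i ≤ F i)
    (h : ∀ i i', i < i' → S i = 0 ∨ S i' = F i') (h' : ∀ i i', i < i' → S' i = 0 ∨ S' i' = F i')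
    (hsum : ∑ i, S i = ∑ i, S' i) : S = S' := by
  have key : ∀ {S S' : Fin k → ℕ}, (∀ i, S i ≤ F i) → (∀ i, S' i ≤ F i) →
      (∀ i i', i < i' → S i = 0 ∨ S i' = F i') → (∀ i i', i < i' → S' i = 0 ∨ S' i' = F i') →
      ∑ i, S i = ∑ i, S' i → ∀ i, S' i ≤ S i := by
    intro S S' hS hS' h h' hsum i
    -- If `S i < S' i`, level `i` is not full in `S`, so `S` vanishes below it; it is not empty in
    -- `S'`, so `S'` is full above it. Then `S ≤ S'` everywhere, strictly at `i`.
    by_contra! hlt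
    refine hsum.not_lt (Finset.sum_lt_sum (fun l _ => ?_) ⟨i, Finset.mem_univ _, hlt⟩)
    rcases lt_trichotomy l i with hl | rfl | hl
    · have := h l i hl
      have := hS' i
      omega
    · exact hlt.le
    · have := h' i l hl
      have := hS l
      omega
  exact funext fun i =>
    le_antisymm (key hS' hS h' h hsum.symm i) (key hS hS' h h' hsum i)

variable {n s : ℕ} {N : Fin (s + 1) → ℕ} {u : (i : Fin (s + 1)) → Fin (N i) → (Fin n →₀ ℕ)}

/-- All pairs of distinct generators occurring in the monomial with exponent vector `α` are
comparable. -/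
def PairwiseComparable (u : (i : Fin (s + 1)) → Fin (N i) → (Fin n →₀ ℕ)) (α : Idx N →₀ ℕ) :
    Prop :=
  ∀ a b : Idx N, LexLT a b → α a ≠ 0 → α b ≠ 0 → Comparable u a b

theorem interlaced_of_comparable {d : Fin (s + 1) → ℕ} (hdeg : ∀ i j, (u i j).degree = d i)
    {i : Fin (s + 1)} {j j' : Fin (N i)} (h : Comparable u ⟨i, j⟩ ⟨i, j'⟩) (x : Fin n) :
    cum x (u i j') ≤ cum x (u i j) ∧ cum x (u i j) ≤ cum x (u i j') + 1 := by
  rcases h.2 with ⟨-, h⟩ | ⟨h, -⟩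
  · exact cum_interlaced_of_sorting_eq (by rw [hdeg, hdeg]) h x
  · exact absurd h (lt_irrefl _)

theorem separated_of_comparable {d : Fin (s + 1) → ℕ} (hdeg : ∀ i j, (u i j).degree = d i)
    {a b : Idx N} (hab : a.1 < b.1) (h : Comparable u a b) (x : Fin n) :
    cum x (u a.1 a.2) = 0 ∨ cum x (u b.1 b.2) = d b.1 := by
  rcases h.2 with ⟨h, -⟩ | ⟨-, h⟩
  · exact absurd h hab.ne
  · rw [← hdeg b.1 b.2]
    exact cum_separated_of_ordering_eq h x

/-- A single factor of level `i` with a letter up to `x` forces every factor of level `i'` to have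
all of its letters there. This is the hypothesis of `eq_of_stacked`, the capacity of a level being
its number of factors times its degree. -/
theorem PairwiseComparable.stacked {d : Fin (s + 1) → ℕ} (hdeg : ∀ i j, (u i j).degree = d i)
    {α : Idx N →₀ ℕ} (hα : PairwiseComparable u α) (x : Fin n) {i i' : Fin (s + 1)} (hi : i < i') :
    ∑ j, α ⟨i, j⟩ * cum x (u i j) = 0 ∨
      ∑ j, α ⟨i', j⟩ * cum x (u i' j) = (∑ j, α ⟨i', j⟩) * d i' := by
  by_cases h0 : ∑ j, α ⟨i, j⟩ * cum x (u i j) = 0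
  · exact Or.inl h0
  · right
    obtain ⟨j, -, hj⟩ := Finset.exists_ne_zero_of_sum_ne_zero h0
    rw [Finset.sum_mul]
    refine Finset.sum_congr rfl fun j' _ => ?_
    by_cases hj' : α ⟨i', j'⟩ = 0
    · simp [hj']
    · have hcomp := hα ⟨i, j⟩ ⟨i', j'⟩ (Or.inl hi) (left_ne_zero_of_mul hj) hj'
      rcases separated_of_comparable hdeg hi hcomp x with h | h
      · exact absurd h (right_ne_zero_of_mul hj)
      · rw [h]

/-- A monomial in which all pairs of generators are comparable is determined by the number of its
generators in each level and the product of all generators. -/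
theorem PairwiseComparable.eq_of_eq {d : Fin (s + 1) → ℕ} (hdeg : ∀ i j, (u i j).degree = d i)
    (hinj : ∀ i, Function.Injective (u i)) {α β : Idx N →₀ ℕ} (hα : PairwiseComparable u α)
    (hβ : PairwiseComparable u β) (hlevel : ∀ i, ∑ j, α ⟨i, j⟩ = ∑ j, β ⟨i, j⟩)
    (hprod : ∀ x, ∑ i, ∑ j, α ⟨i, j⟩ * cum x (u i j) = ∑ i, ∑ j, β ⟨i, j⟩ * cum x (u i j)) :
    α = β := by
  have hle : ∀ (γ : Idx N →₀ ℕ) (x : Fin n) (i : Fin (s + 1)),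
      ∑ j, γ ⟨i, j⟩ * cum x (u i j) ≤ (∑ j, γ ⟨i, j⟩) * d i := fun γ x i => by
    rw [Finset.sum_mul]
    exact Finset.sum_le_sum fun j _ => Nat.mul_le_mul_left _ (hdeg i j ▸ cum_le_degree x _)
  have hlevels : ∀ x i, ∑ j, α ⟨i, j⟩ * cum x (u i j) = ∑ j, β ⟨i, j⟩ * cum x (u i j) :=
    fun x => congrFun <| eq_of_stacked (F := fun i => (∑ j, α ⟨i, j⟩) * d i) (hle α x)
      (fun i => by rw [hlevel]; exact hle β x i) (fun i i' hi => hα.stacked hdeg x hi)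
      (fun i i' hi => by rw [hlevel]; exact hβ.stacked hdeg x hi) (hprod x)
  have hpair : ∀ γ : Idx N →₀ ℕ, PairwiseComparable u γ → ∀ (i : Fin (s + 1)) (j j' : Fin (N i)),
      j < j' → γ ⟨i, j⟩ ≠ 0 → γ ⟨i, j'⟩ ≠ 0 → ∀ x,
        cum x (u i j') ≤ cum x (u i j) ∧ cum x (u i j) ≤ cum x (u i j') + 1 :=
    fun γ hγ i j j' hlt hj hj' x =>
      interlaced_of_comparable hdeg (hγ ⟨i, j⟩ ⟨i, j'⟩ (Or.inr ⟨rfl, hlt⟩) hj hj') x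
  ext ⟨i, j⟩
  exact congrFun (eq_of_pairwise_interlaced (c := fun j x => cum x (u i j))
    (fun j j' h => hinj i (eq_of_cum_eq (congrFun h)))
    (A := fun j => α ⟨i, j⟩) (B := fun j => β ⟨i, j⟩)
    (hpair α hα i) (hpair β hβ i) (hlevel i) fun x => hlevels x i) j

end Uniqueness

end MultiRees

namespace MultiRees

/-! ### The exponent map of `Psi`. -/

section Kernel

open MvPolynomial

variable {n s : ℕ} {N : Fin (s + 1) → ℕ} {u : (i : Fin (s + 1)) → Fin (N i) → (Fin n →₀ ℕ)}

/-- The exponent vector of `u_{ij} t_i`. -/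
noncomputable def psiExp (u : (i : Fin (s + 1)) → Fin (N i) → (Fin n →₀ ℕ)) (a : Idx N) :
    (Fin n ⊕ Fin s) →₀ ℕ :=
  (u a.1 a.2).mapDomain Sum.inl +
    (Fin.cases 0 (fun k => Finsupp.single (Sum.inr k) 1) a.1 : (Fin n ⊕ Fin s) →₀ ℕ)

theorem tVar_eq_monomial (K : Type*) [Field K] (n s : ℕ) (i : Fin (s + 1)) :
    tVar K n s i =
      monomial (Fin.cases 0 (fun k => Finsupp.single (Sum.inr k) 1) i : (Fin n ⊕ Fin s) →₀ ℕ) 1 := by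
  cases i using Fin.cases <;> rfl

theorem Psi_X (K : Type*) [Field K] (u : (i : Fin (s + 1)) → Fin (N i) → (Fin n →₀ ℕ))
    (a : Idx N) : Psi K u (X a) = monomial (psiExp u a) 1 := by
  rw [Psi, aeval_X, rename_monomial, tVar_eq_monomial, monomial_mul, one_mul, psiExp]

theorem psiExp_inl (a : Idx N) (y : Fin n) : psiExp u a (Sum.inl y) = u a.1 a.2 y := by
  rw [psiExp, Finsupp.add_apply, Finsupp.mapDomain_apply Sum.inl_injective]
  have h : ∀ i : Fin (s + 1), (Fin.cases 0 (fun k => Finsupp.single (Sum.inr k) 1) i :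
      (Fin n ⊕ Fin s) →₀ ℕ) (Sum.inl y) = 0 := fun i => by
    cases i using Fin.cases <;> simp
  rw [h, add_zero]

theorem psiExp_inr (a : Idx N) (k : Fin s) :
    psiExp u a (Sum.inr k) = if a.1 = k.succ then 1 else 0 := by
  rw [psiExp, Finsupp.add_apply, Finsupp.mapDomain_of_notMem_range _ _ (by simp), zero_add]
  cases a.1 using Fin.cases with
  | zero => simp [(Fin.succ_ne_zero k).symm]
  | succ l => simp [Finsupp.single_apply]

theorem linearCombination_psiExp_apply (α : Idx N →₀ ℕ) (z : Fin n ⊕ Fin s) :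
    Finsupp.linearCombination ℕ (psiExp u) α z =
      ∑ i, ∑ j, α ⟨i, j⟩ * psiExp u ⟨i, j⟩ z := by
  rw [Finsupp.linearCombination_apply, Finsupp.sum_fintype _ _ (by simp),
    Finsupp.finsetSum_apply, Fintype.sum_sigma]
  rfl

/-- The exponent map of `Ψ` is injective on the monomials in which all pairs of generators are
comparable. -/
theorem injOn_pairwiseComparable {d : Fin (s + 1) → ℕ} (hd0 : d 0 = 1)
    (hdeg : ∀ i j, (u i j).degree = d i) (hinj : ∀ i, Function.Injective (u i)) :
    Set.InjOn (Finsupp.linearCombination ℕ (psiExp u)) {α | PairwiseComparable u α} := by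
  intro α hα β hβ h
  have hinl : ∀ y, ∑ i, ∑ j, α ⟨i, j⟩ * u i j y = ∑ i, ∑ j, β ⟨i, j⟩ * u i j y := fun y => by
    have := DFunLike.congr_fun h (Sum.inl y)
    simpa only [linearCombination_psiExp_apply, psiExp_inl] using this
  have hsucc : ∀ k : Fin s, ∑ j, α ⟨k.succ, j⟩ = ∑ j, β ⟨k.succ, j⟩ := fun k => by
    have := DFunLike.congr_fun h (Sum.inr k)
    simpa [linearCombination_psiExp_apply, psiExp_inr] using this
  have hswap : ∀ (γ : Idx N →₀ ℕ) (T : Finset (Fin n)),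
      ∑ i, ∑ j, γ ⟨i, j⟩ * ∑ y ∈ T, u i j y = ∑ y ∈ T, ∑ i, ∑ j, γ ⟨i, j⟩ * u i j y :=
    fun γ T => by
      simp only [Finset.mul_sum]
      rw [Finset.sum_comm]
      refine Finset.sum_congr rfl fun i _ => ?_
      rw [Finset.sum_comm]
  have hdegsum : ∀ γ : Idx N →₀ ℕ, ∑ i, (∑ j, γ ⟨i, j⟩) * d i =
      ∑ y, ∑ i, ∑ j, γ ⟨i, j⟩ * u i j y := fun γ => by
    rw [← hswap]
    refine Finset.sum_congr rfl fun i _ => ?_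
    rw [Finset.sum_mul]
    exact Finset.sum_congr rfl fun j _ => by rw [← hdeg i j, Finsupp.degree_eq_sum]
  refine PairwiseComparable.eq_of_eq hdeg hinj hα hβ (fun i => ?_) fun x => ?_
  · cases i using Fin.cases with
    | succ k => exact hsucc k
    -- As `t_0 = 1`, no variable records the number of factors in level 0. It is recovered from the
    -- total degree in the `X` variables, because `d 0 = 1`.
    | zero =>
      have h1 : ∑ i, (∑ j, α ⟨i, j⟩) * d i = ∑ i, (∑ j, β ⟨i, j⟩) * d i := by
        rw [hdegsum, hdegsum]
        exact Finset.sum_congr rfl fun y _ => hinl y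
      rw [Fin.sum_univ_succ, Fin.sum_univ_succ, hd0, mul_one, mul_one] at h1
      simp only [hsucc] at h1
      exact Nat.add_right_cancel h1
  · simp only [cum_apply]
    rw [hswap, hswap]
    exact Finset.sum_congr rfl fun y _ => hinl y

theorem Replaces.binomial_mem_ker (K : Type*) [Field K] {a b c e : Idx N}
    (h : Replaces u a b c e) : binomial K a b c e ∈ RingHom.ker (Psi K u) := by
  obtain ⟨i, j⟩ := a
  obtain ⟨i', j'⟩ := b
  obtain ⟨_, l⟩ := c
  obtain ⟨_, l'⟩ := e
  obtain ⟨h1, h2, h3, -⟩ := h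
  dsimp only at h1 h2 h3
  subst h1 h2
  rw [RingHom.mem_ker, binomial, map_sub, map_mul, map_mul, Psi_X, Psi_X, Psi_X, Psi_X,
    monomial_mul, monomial_mul, sub_eq_zero]
  congr 2
  simp only [psiExp]
  rw [add_add_add_comm, add_add_add_comm (Finsupp.mapDomain _ (u _ l)),
    ← Finsupp.mapDomain_add, ← Finsupp.mapDomain_add, h3]

theorem G_finite (K : Type*) [Field K] (u : (i : Fin (s + 1)) → Fin (N i) → (Fin n →₀ ℕ)) :
    (G K u).Finite := by
  refine (Set.finite_range fun q : Idx N × Idx N × Idx N × Idx N =>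
    binomial K q.1 q.2.1 q.2.2.1 q.2.2.2).subset ?_
  rintro _ ⟨a, b, c, e, -, -, -, rfl⟩
  exact ⟨(a, b, c, e), rfl⟩

theorem RevGT.ne {v w : Fin n →₀ ℕ} (h : RevGT v w) : v ≠ w := by
  rintro rfl
  rcases h with h | ⟨-, k, ⟨x, hx, y, hy, hxy⟩, -⟩
  · exact lt_irrefl _ h
  · rw [Option.mem_unique hx hy] at hxy
    exact lt_irrefl _ hxy

end Kernel

/-! ### The monomial order and the initial terms. -/

section Order

open MvPolynomial

variable {n s : ℕ} {N : Fin (s + 1) → ℕ} {u : (i : Fin (s + 1)) → Fin (N i) → (Fin n →₀ ℕ)}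

/-- The weight that decreases when a pair of generators in different levels is replaced by a
comparable pair. -/
noncomputable def levelWeight (u : (i : Fin (s + 1)) → Fin (N i) → (Fin n →₀ ℕ)) :
    (Idx N →₀ ℕ) →+ ℕ :=
  (Finsupp.linearCombination ℕ fun a : Idx N =>
    (s - (a.1 : ℕ)) * ∑ x, cum x (u a.1 a.2)).toAddMonoidHom

/-- The weight that decreases when a pair of generators in the same level is replaced by a
comparable pair. -/
noncomputable def sortWeight (u : (i : Fin (s + 1)) → Fin (N i) → (Fin n →₀ ℕ)) :
    (Idx N →₀ ℕ) →+ ℕ :=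
  (Finsupp.linearCombination ℕ fun a : Idx N => sqWeight (u a.1 a.2)).toAddMonoidHom

theorem levelWeight_pair (a b : Idx N) :
    levelWeight u (Finsupp.single a 1 + Finsupp.single b 1) =
      (s - (a.1 : ℕ)) * ∑ x, cum x (u a.1 a.2) + (s - (b.1 : ℕ)) * ∑ x, cum x (u b.1 b.2) := by
  simp [levelWeight]

theorem sortWeight_pair (a b : Idx N) :
    sortWeight u (Finsupp.single a 1 + Finsupp.single b 1) =
      sqWeight (u a.1 a.2) + sqWeight (u b.1 b.2) := by
  simp [sortWeight]

/-- The lexicographic monomial order for some enumeration of the variables. -/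
noncomputable def enumeratedLex (σ : Type*) [Fintype σ] : MonomialOrder σ :=
  letI : LinearOrder σ := LinearOrder.lift' (Fintype.equivFin σ) (Fintype.equivFin σ).injective
  MonomialOrder.lex

/-- The monomial order that compares the level weights, then the sorting weights. -/
noncomputable def comparabilityOrder (u : (i : Fin (s + 1)) → Fin (N i) → (Fin n →₀ ℕ)) :
    MonomialOrder.{0, 0} (Idx N) :=
  -- The two weights decide every comparison needed below; the lexicographic order only breaks the
  -- remaining ties.
  weightedOrder (weightedOrder (enumeratedLex (Idx N)) (sortWeight u)) (levelWeight u)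

/-- Replacing an incomparable pair of generators by a comparable one makes the monomial smaller. -/
theorem Replaces.lt {d : Fin (s + 1) → ℕ} (hdeg : ∀ i j, (u i j).degree = d i)
    (hinj : ∀ i, Function.Injective (u i)) {a b c e : Idx N} (hab : LexLT a b)
    (hn : ¬ Comparable u a b) (h : Replaces u a b c e) :
    (comparabilityOrder u).toSyn (Finsupp.single c 1 + Finsupp.single e 1) <
      (comparabilityOrder u).toSyn (Finsupp.single a 1 + Finsupp.single b 1) := by
  obtain ⟨i, j⟩ := a
  obtain ⟨i', j'⟩ := b
  obtain ⟨_, l⟩ := c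
  obtain ⟨_, l'⟩ := e
  obtain ⟨h1, h2, h3, h4⟩ := h
  dsimp only at h1 h2 h3
  subst h1 h2
  have hne : ¬ (u _ j = u _ l ∧ u _ j' = u _ l') := by
    rintro ⟨h5, h6⟩
    rw [hinj _ h5, hinj _ h6] at hn
    exact hn h4
  have hs : ∀ x, cum x (u _ j) + cum x (u _ j') = cum x (u _ l) + cum x (u _ l') := fun x => by
    rw [← map_add, ← map_add, h3]
  rcases hab with hlt | ⟨heq, hlt⟩
  · apply weightedOrder_lt_of_weight_lt
    rw [levelWeight_pair, levelWeight_pair]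
    dsimp only at hlt ⊢
    -- In a comparable pair the upper monomial has as many letters up to `x` as possible: all those
    -- available, or its full degree.
    have hle : ∀ x, cum x (u _ j') ≤ cum x (u _ l') := fun x => by
      have h5 := separated_of_comparable hdeg hlt h4 x
      have h6 := cum_le_degree x (u _ j')
      rw [hdeg] at h6
      have h7 := hs x
      dsimp only at h5
      omega
    have hstrict : ∑ x, cum x (u _ j') < ∑ x, cum x (u _ l') := by
      refine Finset.sum_lt_sum (fun x _ => hle x) ?_
      by_contra! hge
      have h5 : u _ j' = u _ l' :=
        eq_of_cum_eq fun x => le_antisymm (hle x) (hge x (Finset.mem_univ _))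
      refine hne ⟨?_, h5⟩
      rw [h5] at h3
      exact add_right_cancel h3
    have hsum : ∑ x, cum x (u _ j) + ∑ x, cum x (u _ j') =
        ∑ x, cum x (u _ l) + ∑ x, cum x (u _ l') := by
      rw [← Finset.sum_add_distrib, ← Finset.sum_add_distrib]
      exact Finset.sum_congr rfl fun x _ => hs x
    obtain ⟨t, ht⟩ := Nat.exists_eq_add_of_lt hstrict
    generalize ∑ x, cum x (u _ j) = A at *
    generalize ∑ x, cum x (u _ j') = B at *
    generalize ∑ x, cum x (u _ l) = C at *
    generalize ∑ x, cum x (u _ l') = D at *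
    obtain rfl : A = C + (t + 1) := by omega
    subst ht
    -- The amount `t + 1` of cumulative count moves from the lower level to the upper one, where its
    -- coefficient `s - i` is strictly smaller.
    have hlev := Nat.sub_lt_sub_left (hlt.trans_le (Fin.le_last _)) hlt
    nlinarith
  · dsimp only at heq
    subst heq
    have hlt : j < j' := hlt
    apply weightedOrder_lt_of_weight_eq
    · rw [levelWeight_pair, levelWeight_pair]
      dsimp only
      rw [← Nat.mul_add, ← Nat.mul_add, ← Finset.sum_add_distrib, ← Finset.sum_add_distrib]
      simp only [hs]
    · apply weightedOrder_lt_of_weight_lt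
      rw [sortWeight_pair, sortWeight_pair]
      refine sqWeight_add_lt h3 (fun x => interlaced_of_comparable hdeg h4 x) hne ?_
      -- The swapped pair cannot occur: comparability requires `c ≤_lex e`, whereas `a <_lex b`.
      rintro ⟨h5, h6⟩
      have h5 := hinj _ h5
      have h6 := hinj _ h6
      subst h5 h6
      rcases h4.1 with (h7 | ⟨-, h7⟩) | h7
      · exact lt_irrefl _ h7
      · exact lt_asymm hlt h7
      · simp only [Sigma.mk.injEq, heq_eq_eq, true_and] at h7
        exact hlt.ne' h7

theorem X_mul_X_eq_monomial {σ K : Type*} [Field K] (a b : σ) :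
    (X a * X b : MvPolynomial σ K) = monomial (Finsupp.single a 1 + Finsupp.single b 1) 1 := by
  rw [X, X, monomial_mul, one_mul]

variable {K : Type*} [Field K] {m : MonomialOrder (Idx N)} {a b c e : Idx N}

theorem degree_binomial
    (h : m.toSyn (Finsupp.single c 1 + Finsupp.single e 1) <
      m.toSyn (Finsupp.single a 1 + Finsupp.single b 1)) :
    m.degree (binomial K a b c e) = Finsupp.single a 1 + Finsupp.single b 1 := by
  classical
  rw [binomial, X_mul_X_eq_monomial, X_mul_X_eq_monomial, MonomialOrder.degree_sub_of_lt]
  · simp [MonomialOrder.degree_monomial]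
  · simpa [MonomialOrder.degree_monomial] using h

theorem monic_binomial
    (h : m.toSyn (Finsupp.single c 1 + Finsupp.single e 1) <
      m.toSyn (Finsupp.single a 1 + Finsupp.single b 1)) :
    m.Monic (binomial K a b c e) := by
  classical
  rw [MonomialOrder.Monic, binomial, X_mul_X_eq_monomial, X_mul_X_eq_monomial,
    MonomialOrder.leadingCoeff_sub_of_lt]
  · simp
  · simpa [MonomialOrder.degree_monomial] using h

theorem LexLT.ne (h : LexLT a b) : a ≠ b := by
  rintro rfl
  rcases h with h | ⟨-, h⟩ <;> exact lt_irrefl _ h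

theorem pairwiseComparable_of_standard
    (hclosed : ClosedUnderComparability u)
    (hlt : ∀ a b c e : Idx N, LexLT a b → ¬ Comparable u a b → Replaces u a b c e →
      m.toSyn (Finsupp.single c 1 + Finsupp.single e 1) <
        m.toSyn (Finsupp.single a 1 + Finsupp.single b 1))
    {α : Idx N →₀ ℕ} (hα : ∀ g ∈ G K u, ¬ m.degree g ≤ α) : PairwiseComparable u α := by
  classical
  intro a b hab ha hb
  by_contra hn
  -- An incomparable pair dividing `α` yields an element of `G` with leading monomial `T_a T_b`.
  -- Since `a ≠ b`, this monomial is squarefree and divides `α`.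
  obtain ⟨c, e, hr⟩ := hclosed a b hab
  refine hα _ ⟨a, b, c, e, hab, hn, hr, rfl⟩ ?_
  rw [degree_binomial (hlt a b c e hab hn hr)]
  intro z
  have hne := hab.ne
  simp only [Finsupp.add_apply, Finsupp.single_apply]
  split_ifs with h1 h2 h2
  · exact absurd (h1.trans h2.symm) hne
  · subst h1; omega
  · subst h2; omega
  · omega

end Order

end MultiRees

/-! ### The main theorem. -/

theorem lemma2p1 {K : Type*} [Field K] {n s : ℕ}
    (I : Fin (s + 1) → Ideal (MvPolynomial (Fin n) K))
    (hI0 : I 0 = Ideal.span (Set.range MvPolynomial.X))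
    (d : Fin (s + 1) → ℕ) (hd0 : d 0 = 1) (hd : Monotone d)
    (N : Fin (s + 1) → ℕ) (u : (i : Fin (s + 1)) → Fin (N i) → (Fin n →₀ ℕ))
    (hgen : ∀ i, MultiRees.IsMinimalMonomialGenerators (Set.range (u i)) (I i))
    (hdeg : ∀ i j, (u i j).degree = d i)
    (hrev : ∀ i j j', j < j' → MultiRees.RevGT (u i j) (u i j'))
    (hclosed : MultiRees.ClosedUnderComparability u) :
    ∃ m : MonomialOrder.{0, 0} (MultiRees.Idx N),
      -- `G` is a Gröbner basis of the kernel and generates it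
      MultiRees.IsGroebnerBasis m (MultiRees.G K u) (RingHom.ker (MultiRees.Psi K u)) ∧
      Ideal.span (MultiRees.G K u) = RingHom.ker (MultiRees.Psi K u) ∧
      -- the initial term of each binomial is the product of the incomparable pair
      (∀ a b c e : MultiRees.Idx N, MultiRees.LexLT a b → ¬ MultiRees.Comparable u a b →
        MultiRees.Replaces u a b c e →
          m.leadingTerm (MultiRees.binomial K a b c e) =
            MvPolynomial.X a * MvPolynomial.X b) ∧
      -- the basis is quadratic with squarefree initial terms
      (∀ g ∈ MultiRees.G K u, g.IsHomogeneous 2 ∧ g ≠ 0 ∧ ∀ a, m.degree g a ≤ 1) := by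
  classical
  -- Listing the generators in strictly decreasing order makes those of one level distinct.
  have hinj : ∀ i, Function.Injective (u i) := fun i j j' h => by
    rcases lt_trichotomy j j' with hlt | heq | hlt
    · exact absurd h (hrev i j j' hlt).ne
    · exact heq
    · exact absurd h.symm (hrev i j' j hlt).ne
  have hlt := fun (a b c e : MultiRees.Idx N) (hab : MultiRees.LexLT a b)
    (hn : ¬ MultiRees.Comparable u a b) (hr : MultiRees.Replaces u a b c e) =>
      hr.lt hdeg hinj hab hn
  have hker : MultiRees.G K u ⊆ (RingHom.ker (MultiRees.Psi K u) : Set _) := by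
    rintro _ ⟨a, b, c, e, -, -, hr, rfl⟩
    exact hr.binomial_mem_ker K
  obtain ⟨hspan, hin⟩ := MultiRees.span_eq_ker_of_injOn_standard
    (MultiRees.comparabilityOrder u) (MultiRees.Psi K u) (MultiRees.psiExp u)
    (MultiRees.Psi_X K u) (MultiRees.G K u) hker
    (by rintro _ ⟨a, b, c, e, hab, hn, hr, rfl⟩
        exact MultiRees.monic_binomial (hlt a b c e hab hn hr))
    ((MultiRees.injOn_pairwiseComparable hd0 hdeg hinj).mono fun α hα =>
      MultiRees.pairwiseComparable_of_standard hclosed hlt hα)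
  refine ⟨MultiRees.comparabilityOrder u, ⟨MultiRees.G_finite K u, hker, hin⟩, hspan, ?_, ?_⟩
  · intro a b c e hab hn hr
    rw [MonomialOrder.leadingTerm, MultiRees.degree_binomial (hlt a b c e hab hn hr),
      (MultiRees.monic_binomial (hlt a b c e hab hn hr)).leadingCoeff_eq_one,
      MultiRees.X_mul_X_eq_monomial]
  · rintro _ ⟨a, b, c, e, hab, hn, hr, rfl⟩
    refine ⟨?_, (MultiRees.monic_binomial (hlt a b c e hab hn hr)).ne_zero, fun z => ?_⟩
    · exact ((MvPolynomial.isHomogeneous_X K a).mul (MvPolynomial.isHomogeneous_X K b)).sub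
        ((MvPolynomial.isHomogeneous_X K c).mul (MvPolynomial.isHomogeneous_X K e))
    · rw [MultiRees.degree_binomial (hlt a b c e hab hn hr)]
      have hne := hab.ne
      simp only [Finsupp.add_apply, Finsupp.single_apply]
      split_ifs with h1 h2 <;> first | omega | exact absurd (h1.trans h2.symm) hne
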